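/- Let $(A,[\cdot,\cdot],\rho)$ be a Lie algebroid of finite rank over a smooth manifold $M$, with differential $d$ on $\Omega^\bullet(A)=\Gamma(\bigwedge^\bullet A^*)$ and Lie derivative $\mathcal L$, and let $H\in\Gamma(\bigwedge^3A^*)$ with $dH=0$. Let $\pi\in\Gamma(\bigwedge^2A)$, $N\in\Gamma(A\otimes A^*)$, $\sigma\in\Gamma(\bigwedge^2A^*)$, put $\pi^\sharp\alpha=\pi(\alpha,\cdot)$, $\sigma^\flat X=\sigma(X,\cdot)$, and let $$J=\begin{pmatrix}N&\pi^\sharp\\ \sigma^\flat&-{}^tN\end{pmatrix}:A\oplus A^*\to A\oplus A^*.$$ Equip $A\oplus A^*$ with the pairing $\langle X+\alpha,Y+\beta\rangle=\beta(X)+\alpha(Y)$ and with the Dorfman bracket of the Courant algebroid $(A\oplus A^*,\mu+H)$, $$[X+\alpha,Y+\beta]=[X,Y]+\mathcal L_X\beta-i_Yd\alpha-H(X,Y,\cdot),$$ and assume that $J$ is an (integrable) c.p.s. structure: $\langle J\mathcal X,\mathcal Y\rangle+\langle\mathcal X,J\mathcal Y\rangle=0$, $J^2=\lambda\,\mathrm{id}$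 with $\lambda\in\{-1,0,1\}$, and $T_J(\mathcal X,\mathcal Y)=[J\mathcal X,J\mathcal Y]-J([J\mathcal X,\mathcal Y]+[\mathcal X,J\mathcal Y]-J[\mathcal X,\mathcal Y])=0$ for all $\mathcal X,\mathcal Y\in\Gamma(A\oplus A^*)$. Then $(\pi,N,\psi,H)$ with $\psi=-d\sigma$ is a Poisson quasi-Nijenhuis structure with background $H$ on $A$, that is: $N\circ\pi^\sharp=\pi^\sharp\circ{}^tN$, $d\psi=0$, $dH=0$, and 1. $\pi$ is a Poisson bivector, $[\pi,\pi]_{SN}=0$; 2. $C_{\pi,N}(\alpha,\beta)=2\,H(\pi^\sharp\alpha,\pi^\sharp\beta,\cdot)$ for all $\alpha,\beta\in\Gamma(A^*)$; 3. $T_N(X,Y)=-\pi^\sharp\big(H(NX,Y,\cdot)-H(NY,X,\cdot)+\psi(X,Y,\cdot)\big)$ for all $X,Y\in\Gamma(A)$; 4. $d_N\psi=d\mathcal H$, where $\mathcal H(X,Y,Z)=H(NX,NY,Z)+H(NY,NZ,X)+H(NZ,NX,Y)$. Here $[X,Y]_N=[NX,Y]+[X,NY]-N[X,Y]$, $T_N(X,Y)=[NX,NY]-N[X,Y]_N$,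 $d_N$ is the operator given by the Cartan formula for the bracket $[\cdot,\cdot]_N$ and the anchor $\rho\circ N$, $[\alpha,\beta]_\pi=\mathcal L_{\pi^\sharp\alpha}\beta-\mathcal L_{\pi^\sharp\beta}\alpha-d(\pi(\alpha,\beta))$, and $C_{\pi,N}=([\cdot,\cdot]_N)_\pi-([\cdot,\cdot]_\pi)_{{}^tN}$. -/

import Mathlib

open scoped Manifold ContDiff

noncomputable section

namespace Algebroid

/-! ### Tensor calculus on the module of sections

`R` plays the role of `C^∞(M)` and `Γ` that of the `C^∞(M)`-module `Γ(A)` of smooth sections of a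
vector bundle `A → M` of finite rank.  Tensor fields are `C^∞(M)`-multilinear maps:
`Γ(A*) = Module.Dual R Γ`, `Γ(⋀ᵏ A*) = Γ [⋀^Fin k]→ₗ[R] R`, `Γ(A ⊗ A*) = Module.End R Γ`. -/

section Sections

variable {R : Type*} [CommRing R] {Γ : Type*} [AddCommGroup Γ] [Module R Γ]

section Alternating

lemma two_add_left (σ : Γ [⋀^Fin 2]→ₗ[R] R) (x y z : Γ) :
    σ ![x + y, z] = σ ![x, z] + σ ![y, z] := AlternatingMap.map_vecCons_add σ ![z] x y

lemma two_smul_left (σ : Γ [⋀^Fin 2]→ₗ[R] R) (c : R) (x z : Γ) :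
    σ ![c • x, z] = c * σ ![x, z] := AlternatingMap.map_vecCons_smul σ ![z] c x

lemma two_swap (σ : Γ [⋀^Fin 2]→ₗ[R] R) (x y : Γ) : σ ![x, y] = -σ ![y, x] := by
  rw [← AlternatingMap.map_swap σ ![y, x] (show (0 : Fin 2) ≠ 1 by decide)]
  congr 1; ext i; fin_cases i <;> simp

lemma two_self (σ : Γ [⋀^Fin 2]→ₗ[R] R) (x : Γ) : σ ![x, x] = 0 :=
  σ.map_eq_zero_of_eq ![x, x] (show ![x, x] 0 = ![x, x] 1 from rfl) (by decide)

lemma three_add_left (σ : Γ [⋀^Fin 3]→ₗ[R] R) (x y z w : Γ) :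
    σ ![x + y, z, w] = σ ![x, z, w] + σ ![y, z, w] := AlternatingMap.map_vecCons_add σ ![z, w] x y

lemma three_smul_left (σ : Γ [⋀^Fin 3]→ₗ[R] R) (c : R) (x z w : Γ) :
    σ ![c • x, z, w] = c * σ ![x, z, w] := AlternatingMap.map_vecCons_smul σ ![z, w] c x

lemma three_swap (σ : Γ [⋀^Fin 3]→ₗ[R] R) (x y z : Γ) : σ ![x, y, z] = -σ ![y, x, z] := by
  rw [← AlternatingMap.map_swap σ ![y, x, z] (show (0 : Fin 3) ≠ 1 by decide)]
  congr 1; ext i; fin_cases i <;> simp [Equiv.swap_apply_of_ne_of_ne]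

lemma three_swap' (σ : Γ [⋀^Fin 3]→ₗ[R] R) (x y z : Γ) : σ ![x, y, z] = -σ ![x, z, y] := by
  rw [← AlternatingMap.map_swap σ ![x, z, y] (show (1 : Fin 3) ≠ 2 by decide)]
  congr 1; ext i; fin_cases i <;> simp [Equiv.swap_apply_of_ne_of_ne]

lemma three_self (σ : Γ [⋀^Fin 3]→ₗ[R] R) (x z : Γ) : σ ![x, x, z] = 0 :=
  σ.map_eq_zero_of_eq ![x, x, z] (show ![x, x, z] 0 = ![x, x, z] 1 from rfl) (by decide)

/-- A function of three variables that is linear in the first one and alternating, as an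
alternating map. -/
def alternating3 (f : Γ → Γ → Γ → R)
    (add : ∀ x x' y z, f (x + x') y z = f x y z + f x' y z)
    (smul : ∀ (c : R) x y z, f (c • x) y z = c * f x y z)
    (swap : ∀ x y z, f x y z = -f y x z) (swap' : ∀ x y z, f x y z = -f x z y)
    (self : ∀ x z, f x x z = 0) : Γ [⋀^Fin 3]→ₗ[R] R where
  toFun v := f (v 0) (v 1) (v 2)
  map_update_add' := by
    have n01 : (0 : Fin 3) ≠ 1 := by decide
    have n02 : (0 : Fin 3) ≠ 2 := by decide
    have n12 : (1 : Fin 3) ≠ 2 := by decide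
    intro _ v i x y
    have h1 : ∀ x y y' z, f x (y + y') z = f x y z + f x y' z := fun x y y' z => by
      rw [swap, add, swap y, swap y']; ring
    have h2 : ∀ x y z z', f x y (z + z') = f x y z + f x y z' := fun x y z z' => by
      rw [swap', h1, swap' x z, swap' x z']; ring
    fin_cases i <;> simp [Function.update_of_ne, n01, n02, n12, n01.symm, n02.symm, n12.symm,
      add, h1, h2]
  map_update_smul' := by
    have n01 : (0 : Fin 3) ≠ 1 := by decide
    have n02 : (0 : Fin 3) ≠ 2 := by decide
    have n12 : (1 : Fin 3) ≠ 2 := by decide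
    intro _ v i c x
    have h1 : ∀ (c : R) x y z, f x (c • y) z = c * f x y z := fun c x y z => by
      rw [swap, smul, swap y]; ring
    have h2 : ∀ (c : R) x y z, f x y (c • z) = c * f x y z := fun c x y z => by
      rw [swap', h1, swap' x z]; ring
    fin_cases i <;> simp [Function.update_of_ne, n01, n02, n12, n01.symm, n02.symm, n12.symm,
      smul, h1, h2]
  map_eq_zero_of_eq' := by
    have s1 : ∀ x y, f x y y = 0 := fun x y => by
      rw [swap x y y, swap' y x y, self]; simp
    have s2 : ∀ x y, f x y x = 0 := fun x y => by rw [swap', self]; simp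
    intro v i j h hij
    fin_cases i <;> fin_cases j <;> first | exact absurd rfl hij | skip
    all_goals simp only [Fin.zero_eta, Fin.mk_one, Fin.reduceFinMk] at h
    · rw [h, self]
    · rw [h, s2]
    · rw [← h, self]
    · rw [h, s1]
    · rw [← h, s2]
    · rw [← h, s1]

/-- `σ♭ X = σ(X, ·)`. -/
def flat (σ : Γ [⋀^Fin 2]→ₗ[R] R) : Γ →ₗ[R] Module.Dual R Γ :=
  LinearMap.mk₂ R (fun X Y => σ ![X, Y]) (two_add_left σ) (fun c X Y => two_smul_left σ c X Y)
    (fun X Y Z => by rw [two_swap, two_add_left, two_swap σ Y, two_swap σ Z]; ring)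
    (fun c X Y => by rw [two_swap, two_smul_left, two_swap σ Y, smul_eq_mul]; ring)

/-- The `1`-form `H(X, Y, ·)`. -/
def insert₂ (H : Γ [⋀^Fin 3]→ₗ[R] R) (X Y : Γ) : Module.Dual R Γ where
  toFun Z := H ![X, Y, Z]
  map_add' Z W := by
    rw [three_swap', three_swap, three_swap' H X Y Z, three_swap H X Z, three_swap' H X Y W,
      three_swap H X W, three_add_left]
    ring
  map_smul' c Z := by
    rw [three_swap', three_swap, three_swap' H X Y Z, three_swap H X Z, three_smul_left]
    simp

/-- The `3`-form `𝓗(X, Y, Z) = H(NX, NY, Z) + H(NY, NZ, X) + H(NZ, NX, Y)`. -/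
def cyclicForm (N : Module.End R Γ) (H : Γ [⋀^Fin 3]→ₗ[R] R) : Γ [⋀^Fin 3]→ₗ[R] R :=
  alternating3 (fun X Y Z => H ![N X, N Y, Z] + H ![N Y, N Z, X] + H ![N Z, N X, Y])
    (fun x x' y z => by
      simp only [map_add, three_add_left]
      rw [three_swap' H (N y) (N z), three_swap H (N y), three_add_left,
        three_swap H (N z) (N x + _), three_add_left, three_swap' H (N y) (N z) x,
        three_swap H (N y) x, three_swap H (N z) (N x), three_swap' H (N y) (N z) x',
        three_swap H (N y) x', three_swap H (N z) (N x')]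
      ring)
    (fun c x y z => by
      simp only [map_smul, three_smul_left]
      rw [three_swap' H (N y) (N z), three_swap H (N y), three_smul_left,
        three_swap H (N z) (c • N x), three_smul_left, three_swap' H (N y) (N z) x,
        three_swap H (N y) x, three_swap H (N z) (N x)]
      ring)
    (fun x y z => by
      rw [three_swap H (N x) (N y), three_swap H (N y) (N z), three_swap H (N z) (N x)]; ring)
    (fun x y z => by
      rw [three_swap H (N x) (N y), three_swap H (N y) (N z), three_swap H (N z) (N x)]; ring)
    (fun x z => by rw [three_self, three_swap H (N x) (N z)]; ring)

end Alternating

variable (R Γ) in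
/-- A bivector field `π ∈ Γ(⋀² A)`, given by the skew-symmetric map `π♯ : Γ(A*) → Γ(A)`,
`π♯ α = π(α, ·)`. -/
structure Bivector where
  sharp : Module.Dual R Γ →ₗ[R] Γ
  alternating : ∀ α : Module.Dual R Γ, α (sharp α) = 0

namespace Bivector

/-- `π(α, β) = ⟨β, π♯ α⟩`. -/
def eval (π : Bivector R Γ) (α β : Module.Dual R Γ) : R := β (π.sharp α)

lemma eval_swap (π : Bivector R Γ) (α β : Module.Dual R Γ) : π.eval α β = -π.eval β α := by
  have h := π.alternating (α + β)
  simp only [map_add, LinearMap.add_apply, π.alternating] at h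
  simp only [eval]
  linear_combination h

end Bivector

/-! ### Brackets with an anchor -/

variable [Algebra ℝ R]

variable (R Γ) in
/-- A skew-symmetric bracket on `Γ` with an anchor, satisfying the Leibniz rule but not necessarily
the Jacobi identity. -/
structure SkewAlgebroid where
  bracket : Γ → Γ → Γ
  anchor : Γ →ₗ[R] Derivation ℝ R R
  add_bracket : ∀ X Y Z, bracket (X + Y) Z = bracket X Z + bracket Y Z
  bracket_add : ∀ X Y Z, bracket X (Y + Z) = bracket X Y + bracket X Z
  bracket_self : ∀ X, bracket X X = 0
  leibniz : ∀ X (f : R) Y, bracket X (f • Y) = f • bracket X Y + anchor X f • Y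

namespace SkewAlgebroid

variable (L : SkewAlgebroid R Γ)

lemma bracket_swap (X Y : Γ) : L.bracket X Y = -L.bracket Y X := by
  have h := L.bracket_self (X + Y)
  simp only [L.add_bracket, L.bracket_add, L.bracket_self, zero_add, add_zero] at h
  exact eq_neg_of_add_eq_zero_left h

lemma smul_bracket (f : R) (X Y : Γ) :
    L.bracket (f • X) Y = f • L.bracket X Y - L.anchor Y f • X := by
  rw [L.bracket_swap, L.leibniz, L.bracket_swap Y X]
  simp only [smul_neg]; abel

/-- The `1`-form `df = (X ↦ ρ(X) f)`. -/
def dFun (f : R) : Module.Dual R Γ where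
  toFun X := L.anchor X f
  map_add' X Y := by simp
  map_smul' c X := by simp

/-- The `1`-form `i_X dα`, where `dα(X, Y) = ρ(X) α(Y) - ρ(Y) α(X) - α([X, Y])`. -/
def insertD (X : Γ) (α : Module.Dual R Γ) : Module.Dual R Γ where
  toFun Y := L.anchor X (α Y) - L.anchor Y (α X) - α (L.bracket X Y)
  map_add' Y Z := by simp [L.bracket_add]; ring
  map_smul' c Y := by simp [L.leibniz]; ring

/-- The Lie derivative of a `1`-form, `(𝓛_X α)(Y) = ρ(X) α(Y) - α([X, Y])`. -/
def lieDeriv (X : Γ) (α : Module.Dual R Γ) : Module.Dual R Γ where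
  toFun Y := L.anchor X (α Y) - α (L.bracket X Y)
  map_add' Y Z := by simp [L.bracket_add]; ring
  map_smul' c Y := by simp [L.leibniz]; ring

/-- The exterior derivative of a `2`-form. -/
def d₂ (σ : Γ [⋀^Fin 2]→ₗ[R] R) : Γ [⋀^Fin 3]→ₗ[R] R :=
  alternating3 (fun X Y Z =>
      L.anchor X (σ ![Y, Z]) - L.anchor Y (σ ![X, Z]) + L.anchor Z (σ ![X, Y])
        - σ ![L.bracket X Y, Z] + σ ![L.bracket X Z, Y] - σ ![L.bracket Y Z, X])
    (fun x x' y z => by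
      rw [two_swap σ (L.bracket y z), two_swap σ (L.bracket y z) x, two_swap σ (L.bracket y z) x']
      simp only [L.add_bracket, two_add_left, map_add, Derivation.add_apply]
      ring)
    (fun c x y z => by
      rw [two_swap σ (L.bracket y z), two_swap σ (L.bracket y z) x]
      simp only [L.smul_bracket, two_smul_left, map_smul, Derivation.smul_apply, sub_eq_add_neg,
        two_add_left, Derivation.leibniz, ← neg_smul, smul_eq_mul]
      ring)
    (fun x y z => by
      have h (u v : Γ) : σ ![-u, v] = -σ ![u, v] := by
        rw [← neg_one_smul R u, two_smul_left]; ring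
      rw [two_swap σ x y, L.bracket_swap x y, h, map_neg]; ring)
    (fun x y z => by
      have h (u v : Γ) : σ ![-u, v] = -σ ![u, v] := by
        rw [← neg_one_smul R u, two_smul_left]; ring
      rw [two_swap σ y z, L.bracket_swap y z, h, map_neg]; ring)
    (fun x z => by
      have h (v : Γ) : σ ![0, v] = 0 := by
        rw [← zero_smul R (0 : Γ), two_smul_left, zero_mul]
      rw [two_self, L.bracket_self, h, map_zero]; ring)

/-- The exterior derivative of a `3`-form, evaluated on four sections. -/
def d₃ (η : Γ [⋀^Fin 3]→ₗ[R] R) (W X Y Z : Γ) : R :=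
  L.anchor W (η ![X, Y, Z]) - L.anchor X (η ![W, Y, Z])
    + L.anchor Y (η ![W, X, Z]) - L.anchor Z (η ![W, X, Y])
    - η ![L.bracket W X, Y, Z] + η ![L.bracket W Y, X, Z] - η ![L.bracket W Z, X, Y]
    - η ![L.bracket X Y, W, Z] + η ![L.bracket X Z, W, Y] - η ![L.bracket Y Z, W, X]

/-- The deformed bracket `[X, Y]_N = [NX, Y] + [X, NY] - N[X, Y]` with anchor `ρ ∘ N`. -/
def deform (N : Module.End R Γ) : SkewAlgebroid R Γ where
  bracket X Y := L.bracket (N X) Y + L.bracket X (N Y) - N (L.bracket X Y)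
  anchor := L.anchor ∘ₗ N
  add_bracket X Y Z := by simp only [map_add, L.add_bracket]; abel
  bracket_add X Y Z := by simp only [map_add, L.bracket_add]; abel
  bracket_self X := by rw [L.bracket_swap (N X), L.bracket_self]; simp
  leibniz X f Y := by
    simp only [map_add, map_smul, L.leibniz, smul_add, smul_sub, LinearMap.comp_apply]; abel

/-- The bracket `[α, β]_π = 𝓛_{π♯α} β - 𝓛_{π♯β} α - d(π(α, β))` on `Γ(A*)` with anchor
`ρ ∘ π♯`. -/
def koszul (π : Bivector R Γ) : SkewAlgebroid R (Module.Dual R Γ) where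
  bracket α β :=
    L.lieDeriv (π.sharp α) β - L.lieDeriv (π.sharp β) α - L.dFun (π.eval α β)
  anchor := L.anchor ∘ₗ π.sharp
  add_bracket α β γ := by
    ext X
    simp [lieDeriv, dFun, Bivector.eval, L.add_bracket]; ring
  bracket_add α β γ := by
    ext X
    simp [lieDeriv, dFun, Bivector.eval, L.add_bracket]; ring
  bracket_self α := by
    ext X
    simp [lieDeriv, dFun, Bivector.eval, π.alternating]
  leibniz α f β := by
    ext X
    have h : α (π.sharp β) = -β (π.sharp α) := π.eval_swap β α
    simp [lieDeriv, dFun, Bivector.eval, L.smul_bracket, h]; ring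

/-- The Schouten–Nijenhuis bracket of two bivectors,
`[P, Q](α, β, γ) = ∑ (⟨𝓛_{P♯α} β, Q♯γ⟩ + ⟨𝓛_{Q♯α} β, P♯γ⟩)`, summed over the cyclic permutations of
`(α, β, γ)`. -/
def schouten (P Q : Bivector R Γ) (α β γ : Module.Dual R Γ) : R :=
  (L.lieDeriv (P.sharp α) β (Q.sharp γ) + L.lieDeriv (Q.sharp α) β (P.sharp γ))
    + (L.lieDeriv (P.sharp β) γ (Q.sharp α) + L.lieDeriv (Q.sharp β) γ (P.sharp α))
    + (L.lieDeriv (P.sharp γ) α (Q.sharp β) + L.lieDeriv (Q.sharp γ) α (P.sharp β))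

/-- `π` is a Poisson bivector: `[π, π] = 0`. -/
def IsPoisson (π : Bivector R Γ) : Prop := ∀ α β γ, L.schouten π π α β γ = 0

/-- The Nijenhuis torsion `T_N(X, Y) = [NX, NY] - N([NX, Y] + [X, NY] - N[X, Y])`. -/
def torsion (N : Module.End R Γ) (X Y : Γ) : Γ :=
  L.bracket (N X) (N Y) - N ((L.deform N).bracket X Y)

/-- `C_{π,N} = ([·,·]_N)_π - ([·,·]_π)_{ᵗN}`. -/
def concomitant (π : Bivector R Γ) (N : Module.End R Γ) (α β : Module.Dual R Γ) :
    Module.Dual R Γ :=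
  ((L.deform N).koszul π).bracket α β - ((L.koszul π).deform N.dualMap).bracket α β

/-- Poisson quasi-Nijenhuis structures `(π, N, ψ, H)` with background. With `i_{X∧Y} = i_X i_Y`,
i.e. `i_{X∧Y} η = -η(X, Y, ·)`, the conditions on the concomitant and the torsion read
`C_{π,N}(α, β) = -2 i_{π♯α∧π♯β} H` and
`T_N(X, Y) = π♯(i_{NX∧Y} H - i_{NY∧X} H + i_{X∧Y} ψ)`. -/
structure IsPoissonQuasiNijenhuis (π : Bivector R Γ) (N : Module.End R Γ)
    (ψ H : Γ [⋀^Fin 3]→ₗ[R] R) : Prop where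
  comm : N ∘ₗ π.sharp = π.sharp ∘ₗ N.dualMap
  closed : ∀ W X Y Z, L.d₃ ψ W X Y Z = 0
  closed_background : ∀ W X Y Z, L.d₃ H W X Y Z = 0
  poisson : L.IsPoisson π
  concomitant_eq : ∀ α β, L.concomitant π N α β = (2 : R) • insert₂ H (π.sharp α) (π.sharp β)
  torsion_eq : ∀ X Y, L.torsion N X Y =
    -π.sharp (insert₂ H (N X) Y - insert₂ H (N Y) X + insert₂ ψ X Y)
  d_eq : ∀ W X Y Z, (L.deform N).d₃ ψ W X Y Z = L.d₃ (cyclicForm N H) W X Y Z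

/-! ### The Courant algebroid `(A ⊕ A*, μ + H)` -/

/-- The Dorfman bracket on `Γ(A ⊕ A*)` with background `H`,
`[X + α, Y + β] = [X, Y] + 𝓛_X β - i_Y dα + i_X i_Y H`; this is the derived bracket
`{{X + α, μ + H}, Y + β}` of the big bracket. Note `i_X i_Y H = -H(X, Y, ·)`. -/
def dorfman (H : Γ [⋀^Fin 3]→ₗ[R] R) (u v : Γ × Module.Dual R Γ) : Γ × Module.Dual R Γ :=
  (L.bracket u.1 v.1, L.lieDeriv u.1 v.2 - L.insertD v.1 u.2 - insert₂ H u.1 v.1)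

/-- `T_J(u, v) = [Ju, Jv] - J([Ju, v] + [u, Jv] - J[u, v])` for the Dorfman bracket. -/
def courantTorsion (H : Γ [⋀^Fin 3]→ₗ[R] R) (J : Module.End R (Γ × Module.Dual R Γ))
    (u v : Γ × Module.Dual R Γ) : Γ × Module.Dual R Γ :=
  L.dorfman H (J u) (J v) - J (L.dorfman H (J u) v + L.dorfman H u (J v) - J (L.dorfman H u v))

end SkewAlgebroid

/-- `⟨X + α, Y + β⟩ = β(X) + α(Y)`. -/
def pairing (u v : Γ × Module.Dual R Γ) : R := v.2 u.1 + u.2 v.1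

/-- The endomorphism `X + α ↦ (NX + π♯α) + (σ♭X - ᵗNα)` of `A ⊕ A*`. -/
def matrixJ (π : Bivector R Γ) (N : Module.End R Γ) (σ : Γ [⋀^Fin 2]→ₗ[R] R) :
    Module.End R (Γ × Module.Dual R Γ) :=
  LinearMap.prod (N.coprod π.sharp) ((flat σ).coprod (-N.dualMap))

/-- `J` is an integrable complex (`lam = -1`), product (`lam = 1`) or subtangent (`lam = 0`)
structure on the Courant algebroid `(A ⊕ A*, μ + H)`. -/
structure SkewAlgebroid.IsCPS (L : SkewAlgebroid R Γ) (H : Γ [⋀^Fin 3]→ₗ[R] R)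
    (J : Module.End R (Γ × Module.Dual R Γ)) (lam : ℝ) : Prop where
  lam_mem : lam = -1 ∨ lam = 0 ∨ lam = 1
  orthogonal : ∀ u v, pairing (J u) v + pairing u (J v) = 0
  sq : ∀ u, J (J u) = algebraMap ℝ R lam • u
  integrable : ∀ u v, L.courantTorsion H J u v = 0

end Sections

/-! ### Lie algebroids over smooth manifolds -/

section Bundle

variable {E : Type*} [NormedAddCommGroup E] [NormedSpace ℝ E]
  {M : Type*} [TopologicalSpace M] [ChartedSpace E M]
  {F : Type*} [NormedAddCommGroup F] [NormedSpace ℝ F]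
  {V : M → Type*} [TopologicalSpace (Bundle.TotalSpace F V)] [∀ x, TopologicalSpace (V x)]
  [∀ x, AddCommGroup (V x)] [∀ x, Module ℝ (V x)] [FiberBundle F V] [VectorBundle ℝ F V]

/-- The smooth sections of a vector bundle form a module over the smooth functions. -/
instance sectionModule : Module C^∞⟮𝓘(ℝ, E), M; ℝ⟯ Cₛ^∞⟮𝓘(ℝ, E); F, V⟯ where
  smul f s := ⟨fun x => f x • s x, f.contMDiff.smul_section s.contMDiff⟩
  one_smul s := by ext x; exact one_smul ℝ (s x)
  mul_smul f g s := by ext x; exact mul_smul (f x) (g x) (s x)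
  smul_zero f := by ext x; exact smul_zero (f x)
  smul_add f s t := by ext x; exact smul_add (f x) (s x) (t x)
  add_smul f g s := by ext x; exact add_smul (f x) (g x) (s x)
  zero_smul s := by ext x; exact zero_smul ℝ (s x)

lemma section_smul_apply (f : C^∞⟮𝓘(ℝ, E), M; ℝ⟯) (s : Cₛ^∞⟮𝓘(ℝ, E); F, V⟯) (x : M) :
    (f • s) x = f x • s x := rfl

variable [IsManifold 𝓘(ℝ, E) ∞ M]

/-- A smooth vector field `v` acts on smooth functions as a derivation, `(v f)(x) = df_x(v_x)`. -/
def vectorFieldDerivation (v : Cₛ^∞⟮𝓘(ℝ, E); E, (TangentSpace 𝓘(ℝ, E) : M → Type _)⟯) :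
    Derivation ℝ C^∞⟮𝓘(ℝ, E), M; ℝ⟯ C^∞⟮𝓘(ℝ, E), M; ℝ⟯ :=
  Derivation.mk'
    { toFun := fun f => ⟨fun x => mvfderiv 𝓘(ℝ, E) f x (v x), by
        have h := (f.contMDiff.contMDiff_tangentMap (m := ∞) (by simp)).comp v.contMDiff
        exact (contMDiff_snd_tangentBundle_modelSpace ℝ 𝓘(ℝ, ℝ)).comp h⟩
      map_add' := fun f g => by
        ext x
        change mvfderiv 𝓘(ℝ, E) (⇑f + ⇑g) x (v x) = _
        rw [mvfderiv_add f.mdifferentiableAt g.mdifferentiableAt]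
        rfl
      map_smul' := fun c f => by
        ext x
        change mvfderiv 𝓘(ℝ, E) ((fun _ : M => c) • ⇑f) x (v x) = _
        rw [mvfderiv_smul mdifferentiableAt_const f.mdifferentiableAt, mvfderiv_const]
        simp
        rfl }
    (fun f g => by
      ext x
      change mvfderiv 𝓘(ℝ, E) (⇑f * ⇑g) x (v x) = _
      rw [mvfderiv_mul f.mdifferentiableAt g.mdifferentiableAt]
      rfl)

/-- A smooth bundle map `ρ : A → TM` over the identity, applied to a smooth section of `A`. -/
def anchorApply [ContMDiffVectorBundle ∞ F V 𝓘(ℝ, E)]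
    (ρ : Cₛ^∞⟮𝓘(ℝ, E); F →L[ℝ] E, fun x : M => V x →L[ℝ] TangentSpace 𝓘(ℝ, E) x⟯)
    (X : Cₛ^∞⟮𝓘(ℝ, E); F, V⟯) :
    Cₛ^∞⟮𝓘(ℝ, E); E, (TangentSpace 𝓘(ℝ, E) : M → Type _)⟯ :=
  ⟨fun x => ρ x (X x), ρ.contMDiff.clm_bundle_apply X.contMDiff⟩

/-- The action `f ↦ ρ(X) f` of sections on functions. -/
def anchorAction [ContMDiffVectorBundle ∞ F V 𝓘(ℝ, E)]
    (ρ : Cₛ^∞⟮𝓘(ℝ, E); F →L[ℝ] E, fun x : M => V x →L[ℝ] TangentSpace 𝓘(ℝ, E) x⟯) :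
    Cₛ^∞⟮𝓘(ℝ, E); F, V⟯ →ₗ[C^∞⟮𝓘(ℝ, E), M; ℝ⟯]
      Derivation ℝ C^∞⟮𝓘(ℝ, E), M; ℝ⟯ C^∞⟮𝓘(ℝ, E), M; ℝ⟯ where
  toFun X := vectorFieldDerivation (anchorApply ρ X)
  map_add' X Y := by
    ext f x
    change mvfderiv 𝓘(ℝ, E) f x (ρ x (X x + Y x)) =
      mvfderiv 𝓘(ℝ, E) f x (ρ x (X x)) + mvfderiv 𝓘(ℝ, E) f x (ρ x (Y x))
    rw [map_add, map_add]
  map_smul' c X := by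
    ext f x
    change mvfderiv 𝓘(ℝ, E) f x (ρ x (c x • X x)) = c x • mvfderiv 𝓘(ℝ, E) f x (ρ x (X x))
    rw [map_smul, map_smul]

variable (E F V) in
/-- A Lie algebroid structure on the smooth vector bundle `V → M`: a Lie bracket on the smooth
sections and a bundle map `ρ : V → TM` compatible with the brackets, such that
`[X, fY] = f[X, Y] + (ρ(X)f)Y`. -/
structure LieAlgebroid [ContMDiffVectorBundle ∞ F V 𝓘(ℝ, E)] where
  bracket : Cₛ^∞⟮𝓘(ℝ, E); F, V⟯ → Cₛ^∞⟮𝓘(ℝ, E); F, V⟯ → Cₛ^∞⟮𝓘(ℝ, E); F, V⟯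
  anchor : Cₛ^∞⟮𝓘(ℝ, E); F →L[ℝ] E, fun x : M => V x →L[ℝ] TangentSpace 𝓘(ℝ, E) x⟯
  add_bracket : ∀ X Y Z, bracket (X + Y) Z = bracket X Z + bracket Y Z
  bracket_add : ∀ X Y Z, bracket X (Y + Z) = bracket X Y + bracket X Z
  bracket_self : ∀ X, bracket X X = 0
  jacobi : ∀ X Y Z,
    bracket X (bracket Y Z) = bracket (bracket X Y) Z + bracket Y (bracket X Z)
  leibniz : ∀ X (f : C^∞⟮𝓘(ℝ, E), M; ℝ⟯) Y,
    bracket X (f • Y) = f • bracket X Y + anchorAction anchor X f • Y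
  anchor_bracket : ∀ X Y,
    anchorAction anchor (bracket X Y) = ⁅anchorAction anchor X, anchorAction anchor Y⁆

/-- The bracket and the anchor of a Lie algebroid, on the level of sections. -/
def LieAlgebroid.toSkewAlgebroid [ContMDiffVectorBundle ∞ F V 𝓘(ℝ, E)]
    (A : LieAlgebroid E F V) :
    SkewAlgebroid C^∞⟮𝓘(ℝ, E), M; ℝ⟯ Cₛ^∞⟮𝓘(ℝ, E); F, V⟯ where
  bracket := A.bracket
  anchor := anchorAction A.anchor
  add_bracket := A.add_bracket
  bracket_add := A.bracket_add
  bracket_self := A.bracket_self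
  leibniz := A.leibniz

end Bundle

end Algebroid

end

/-! Writing `T_J` out on pairs of forms and on pairs of vectors, with `d_N = [i_N, d]` and
`[α, β]_π = 𝓛_{π♯α} β - i_{π♯β} dα`, gives four components:

* the vector part on forms is `[π♯α, π♯β] - π♯[α, β]_π`, which is half of `[π, π]`;
* the form part on forms is half of `C_{π,N}(α, β) - 2 H(π♯α, π♯β, ·)`;
* the vector part on vectors is `T_N(X, Y) + π♯(H(NX, Y, ·) + H(X, NY, ·) - dσ(X, Y, ·))`;
* the form part on vectors is the `3`-form `i_N dσ - dσ_N - 𝓗 - λ H`, where `σ_N = σ(N·, ·)`.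

The last one vanishes, so applying `d` gives `d(i_N dσ) = d𝓗`, and `d_N dσ = -d(i_N dσ)` because
`dσ` is closed. -/

noncomputable section

namespace Algebroid

section Forms

variable {R : Type*} [CommRing R] {Γ : Type*} [AddCommGroup Γ] [Module R Γ]

lemma two_sub_left (σ : Γ [⋀^Fin 2]→ₗ[R] R) (x y z : Γ) :
    σ ![x - y, z] = σ ![x, z] - σ ![y, z] :=
  DFunLike.congr_fun (map_sub σ.curryLeft x y) ![z]

lemma three_sub_left (η : Γ [⋀^Fin 3]→ₗ[R] R) (x y z w : Γ) :
    η ![x - y, z, w] = η ![x, z, w] - η ![y, z, w] :=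
  DFunLike.congr_fun (map_sub η.curryLeft x y) ![z, w]

lemma three_rotate (η : Γ [⋀^Fin 3]→ₗ[R] R) (x y z : Γ) : η ![x, y, z] = η ![y, z, x] := by
  rw [three_swap, three_swap' η y x, neg_neg]

lemma flat_apply (σ : Γ [⋀^Fin 2]→ₗ[R] R) (X Y : Γ) : flat σ X Y = σ ![X, Y] := rfl

/-- The `2`-form `σ` with `σ♭ = B`, for an alternating bilinear form `B`. -/
def formOfFlat (B : Γ →ₗ[R] Module.Dual R Γ) (hB : B.IsAlt) : Γ [⋀^Fin 2]→ₗ[R] R where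
  toFun v := B (v 0) (v 1)
  map_update_add' v i X Y := by fin_cases i <;> simp
  map_update_smul' v i c X := by fin_cases i <;> simp
  map_eq_zero_of_eq' v i j h hij := by
    fin_cases i <;> fin_cases j <;> simp_all [hB.self_eq_zero]

lemma flat_formOfFlat (B : Γ →ₗ[R] Module.Dual R Γ) (hB : B.IsAlt) :
    flat (formOfFlat B hB) = B := rfl

lemma insert₂_apply (η : Γ [⋀^Fin 3]→ₗ[R] R) (X Y Z : Γ) : insert₂ η X Y Z = η ![X, Y, Z] := rfl

lemma ext_insert₂ {η θ : Γ [⋀^Fin 3]→ₗ[R] R}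
    (h : ∀ X Y, insert₂ η X Y = insert₂ θ X Y) : η = θ := by
  ext v
  have hv : v = ![v 0, v 1, v 2] := by ext i; fin_cases i <;> rfl
  rw [hv]
  exact DFunLike.congr_fun (h _ _) _

lemma insert₂_swap (η : Γ [⋀^Fin 3]→ₗ[R] R) (X Y : Γ) : insert₂ η X Y = -insert₂ η Y X :=
  LinearMap.ext (three_swap η X Y)

lemma insert₂_zero_left (η : Γ [⋀^Fin 3]→ₗ[R] R) (Y : Γ) : insert₂ η 0 Y = 0 :=
  LinearMap.ext fun Z => DFunLike.congr_fun (map_zero η.curryLeft) ![Y, Z]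

lemma insert₂_zero_right (η : Γ [⋀^Fin 3]→ₗ[R] R) (X : Γ) : insert₂ η X 0 = 0 := by
  rw [insert₂_swap, insert₂_zero_left, neg_zero]

lemma insert₂_add (η θ : Γ [⋀^Fin 3]→ₗ[R] R) (X Y : Γ) :
    insert₂ (η + θ) X Y = insert₂ η X Y + insert₂ θ X Y := rfl

lemma insert₂_neg (η : Γ [⋀^Fin 3]→ₗ[R] R) (X Y : Γ) :
    insert₂ (-η) X Y = -insert₂ η X Y := rfl

lemma insert₂_sub (η θ : Γ [⋀^Fin 3]→ₗ[R] R) (X Y : Γ) :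
    insert₂ (η - θ) X Y = insert₂ η X Y - insert₂ θ X Y := rfl

lemma insert₂_smul (c : R) (η : Γ [⋀^Fin 3]→ₗ[R] R) (X Y : Γ) :
    insert₂ (c • η) X Y = c • insert₂ η X Y := rfl

/-- The derivation `i_N` of degree `0` on `3`-forms,
`i_N η(X, Y, Z) = η(NX, Y, Z) + η(X, NY, Z) + η(X, Y, NZ)`. -/
def insertEnd (N : Module.End R Γ) (η : Γ [⋀^Fin 3]→ₗ[R] R) : Γ [⋀^Fin 3]→ₗ[R] R :=
  alternating3 (fun X Y Z => η ![N X, Y, Z] + η ![X, N Y, Z] + η ![X, Y, N Z])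
    (fun X X' Y Z => by simp only [map_add, three_add_left]; ring)
    (fun c X Y Z => by simp only [map_smul, three_smul_left]; ring)
    (fun X Y Z => by rw [three_swap η (N X), three_swap η X, three_swap η X Y]; ring)
    (fun X Y Z => by rw [three_swap' η (N X), three_swap' η X, three_swap' η X Y]; ring)
    (fun X Z => by rw [three_swap η (N X), three_self]; ring)

lemma insertEnd_apply (N : Module.End R Γ) (η : Γ [⋀^Fin 3]→ₗ[R] R) (X Y Z : Γ) :
    insertEnd N η ![X, Y, Z] = η ![N X, Y, Z] + η ![X, N Y, Z] + η ![X, Y, N Z] := rfl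

lemma insert₂_insertEnd (N : Module.End R Γ) (η : Γ [⋀^Fin 3]→ₗ[R] R) (X Y : Γ) :
    insert₂ (insertEnd N η) X Y =
      insert₂ η (N X) Y + insert₂ η X (N Y) + N.dualMap (insert₂ η X Y) := rfl

lemma insert₂_cyclicForm (N : Module.End R Γ) (η : Γ [⋀^Fin 3]→ₗ[R] R) (X Y : Γ) :
    insert₂ (cyclicForm N η) X Y =
      insert₂ η (N X) (N Y) + N.dualMap (insert₂ η (N X) Y + insert₂ η X (N Y)) := by
  ext Z
  change η ![N X, N Y, Z] + η ![N Y, N Z, X] + η ![N Z, N X, Y] =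
    η ![N X, N Y, Z] + (η ![N X, Y, N Z] + η ![X, N Y, N Z])
  rw [three_rotate η (N Z), three_rotate η X]
  ring

end Forms

section MatrixJ

variable {R : Type*} [CommRing R] {Γ : Type*} [AddCommGroup Γ] [Module R Γ]
  {π : Bivector R Γ} {N : Module.End R Γ} {σ : Γ [⋀^Fin 2]→ₗ[R] R} {c : R}

lemma matrixJ_apply (π : Bivector R Γ) (N : Module.End R Γ) (σ : Γ [⋀^Fin 2]→ₗ[R] R)
    (X : Γ) (α : Module.Dual R Γ) :
    matrixJ π N σ (X, α) = (N X + π.sharp α, flat σ X - N.dualMap α) := by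
  simp [matrixJ, sub_eq_add_neg]

lemma sharp_comm_of_sq (hsq : ∀ u, matrixJ π N σ (matrixJ π N σ u) = c • u) :
    N ∘ₗ π.sharp = π.sharp ∘ₗ N.dualMap := by
  ext1 α
  simpa [matrixJ_apply, sub_eq_zero, ← sub_eq_add_neg] using congrArg Prod.fst (hsq (0, α))

lemma flat_comm_of_sq (hsq : ∀ u, matrixJ π N σ (matrixJ π N σ u) = c • u) :
    flat σ ∘ₗ N = N.dualMap ∘ₗ flat σ := by
  ext X Y
  simpa [matrixJ_apply, sub_eq_zero] using congrArg (fun u => u.2 Y) (hsq (X, 0))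

lemma flat_sharp_of_sq (hsq : ∀ u, matrixJ π N σ (matrixJ π N σ u) = c • u)
    (α : Module.Dual R Γ) :
    flat σ (π.sharp α) = c • α - N.dualMap (N.dualMap α) := by
  have h := congrArg Prod.snd (hsq (0, α))
  simp only [matrixJ_apply, map_zero, zero_add, zero_sub, map_neg, sub_neg_eq_add,
    Prod.smul_mk] at h
  exact eq_sub_of_add_eq h

lemma isAlt_flat_comp_of_comm [IsAddTorsionFree R]
    (h : flat σ ∘ₗ N = N.dualMap ∘ₗ flat σ) : (flat σ ∘ₗ N).IsAlt := by
  intro X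
  have hX : σ ![N X, X] = -σ ![N X, X] :=
    (congrArg (fun f => f X X) h).trans (two_swap σ X (N X))
  exact self_eq_neg.mp hX

end MatrixJ

namespace SkewAlgebroid

variable {R : Type*} [CommRing R] [Algebra ℝ R] {Γ : Type*} [AddCommGroup Γ] [Module R Γ]
  (L : SkewAlgebroid R Γ)

/-- The axioms that make a bracket with an anchor a Lie algebroid: the Jacobi identity, and the
compatibility of the anchor with the brackets. -/
structure IsLieAlgebroid : Prop where
  jacobi : ∀ X Y Z, L.bracket X (L.bracket Y Z) =
    L.bracket (L.bracket X Y) Z + L.bracket Y (L.bracket X Z)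
  anchor_bracket : ∀ X Y, L.anchor (L.bracket X Y) = ⁅L.anchor X, L.anchor Y⁆

section CartanCalculus

lemma zero_bracket (X : Γ) : L.bracket 0 X = 0 := by
  simpa using L.add_bracket 0 0 X

lemma bracket_zero (X : Γ) : L.bracket X 0 = 0 := by
  simpa using L.bracket_add X 0 0

lemma lieDeriv_apply (X Y : Γ) (α : Module.Dual R Γ) :
    L.lieDeriv X α Y = L.anchor X (α Y) - α (L.bracket X Y) := rfl

lemma insertD_apply (X Y : Γ) (α : Module.Dual R Γ) :
    L.insertD X α Y = L.anchor X (α Y) - L.anchor Y (α X) - α (L.bracket X Y) := rfl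

lemma dFun_apply (f : R) (X : Γ) : L.dFun f X = L.anchor X f := rfl

lemma dFun_algebraMap (a : ℝ) : L.dFun (algebraMap ℝ R a) = 0 :=
  LinearMap.ext fun X => (L.anchor X).map_algebraMap a

lemma lieDeriv_zero (X : Γ) : L.lieDeriv X 0 = 0 := by
  ext; simp [lieDeriv_apply]

lemma zero_lieDeriv (α : Module.Dual R Γ) : L.lieDeriv 0 α = 0 := by
  ext; simp [lieDeriv_apply, zero_bracket]

lemma lieDeriv_neg (X : Γ) (α : Module.Dual R Γ) : L.lieDeriv X (-α) = -L.lieDeriv X α := by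
  ext
  simp only [lieDeriv_apply, LinearMap.neg_apply, map_neg]
  ring

lemma insertD_zero (X : Γ) : L.insertD X 0 = 0 := by
  ext; simp [insertD_apply]

lemma zero_insertD (α : Module.Dual R Γ) : L.insertD 0 α = 0 := by
  ext; simp [insertD_apply, zero_bracket]

lemma insertD_neg (X : Γ) (α : Module.Dual R Γ) : L.insertD X (-α) = -L.insertD X α := by
  ext
  simp only [insertD_apply, LinearMap.neg_apply, map_neg]
  ring

lemma d₂_apply (σ : Γ [⋀^Fin 2]→ₗ[R] R) (X Y Z : Γ) :
    L.d₂ σ ![X, Y, Z] =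
      L.anchor X (σ ![Y, Z]) - L.anchor Y (σ ![X, Z]) + L.anchor Z (σ ![X, Y])
        - σ ![L.bracket X Y, Z] + σ ![L.bracket X Z, Y] - σ ![L.bracket Y Z, X] := rfl

lemma insert₂_d₂ (σ : Γ [⋀^Fin 2]→ₗ[R] R) (X Y : Γ) :
    insert₂ (L.d₂ σ) X Y =
      L.lieDeriv X (flat σ Y) - L.insertD Y (flat σ X) - flat σ (L.bracket X Y) := by
  ext Z
  simp only [insert₂_apply, d₂_apply, lieDeriv_apply, insertD_apply, flat_apply,
    LinearMap.sub_apply]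
  rw [two_swap σ Y (L.bracket X Z), two_swap σ X (L.bracket Y Z)]
  ring

lemma d₃_add (η θ : Γ [⋀^Fin 3]→ₗ[R] R) (W X Y Z : Γ) :
    L.d₃ (η + θ) W X Y Z = L.d₃ η W X Y Z + L.d₃ θ W X Y Z := by
  simp only [d₃, AlternatingMap.add_apply, map_add]; ring

lemma d₃_neg (η : Γ [⋀^Fin 3]→ₗ[R] R) (W X Y Z : Γ) :
    L.d₃ (-η) W X Y Z = -L.d₃ η W X Y Z := by
  simp only [d₃, AlternatingMap.neg_apply, map_neg]; ring

variable {L} in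
lemma d₃_smul_of_dFun_eq_zero {c : R} (hc : L.dFun c = 0) (η : Γ [⋀^Fin 3]→ₗ[R] R)
    (W X Y Z : Γ) : L.d₃ (c • η) W X Y Z = c * L.d₃ η W X Y Z := by
  have hc' (X : Γ) : L.anchor X c = 0 := DFunLike.congr_fun hc X
  simp only [d₃, AlternatingMap.smul_apply, smul_eq_mul, Derivation.leibniz, hc']
  ring

variable {L} in
lemma IsLieAlgebroid.d₃_d₂ (hL : L.IsLieAlgebroid) (σ : Γ [⋀^Fin 2]→ₗ[R] R) (W X Y Z : Γ) :
    L.d₃ (L.d₂ σ) W X Y Z = 0 := by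
  have jacobi (X Y Z T : Γ) : σ ![L.bracket (L.bracket X Y) Z, T] =
      σ ![L.bracket (L.bracket X Z) Y, T] - σ ![L.bracket (L.bracket Y Z) X, T] := by
    rw [← two_sub_left, L.bracket_swap (L.bracket X Z), L.bracket_swap (L.bracket Y Z),
      hL.jacobi X Y Z]
    congr 2
    abel
  simp only [d₃, d₂_apply, hL.anchor_bracket, Derivation.commutator_apply, map_add, map_sub]
  rw [jacobi W X Y Z, jacobi W X Z Y, jacobi W Y Z X, jacobi X Y Z W,
    two_swap σ (L.bracket X Y) (L.bracket W Z), two_swap σ (L.bracket X Z) (L.bracket W Y),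
    two_swap σ (L.bracket Y Z) (L.bracket W X)]
  ring

lemma lieDeriv_deform (N : Module.End R Γ) (X : Γ) (α : Module.Dual R Γ) :
    (L.deform N).lieDeriv X α =
      L.lieDeriv (N X) α + N.dualMap (L.lieDeriv X α) - L.lieDeriv X (N.dualMap α) := by
  ext Y
  simp only [lieDeriv_apply, deform, LinearMap.comp_apply, map_add, map_sub,
    LinearMap.add_apply, LinearMap.sub_apply, LinearMap.dualMap_apply]
  ring

lemma insertD_deform (N : Module.End R Γ) (X : Γ) (α : Module.Dual R Γ) :
    (L.deform N).insertD X α =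
      L.insertD (N X) α + N.dualMap (L.insertD X α) - L.insertD X (N.dualMap α) := by
  ext Y
  simp only [insertD_apply, deform, LinearMap.comp_apply, map_add, map_sub,
    LinearMap.add_apply, LinearMap.sub_apply, LinearMap.dualMap_apply]
  ring

lemma d₃_deform (N : Module.End R Γ) (η : Γ [⋀^Fin 3]→ₗ[R] R) (W X Y Z : Γ) :
    (L.deform N).d₃ η W X Y Z = L.d₃ η (N W) X Y Z + L.d₃ η W (N X) Y Z + L.d₃ η W X (N Y) Z
      + L.d₃ η W X Y (N Z) - L.d₃ (insertEnd N η) W X Y Z := by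
  simp only [d₃, deform, insertEnd_apply, LinearMap.comp_apply, map_add, three_add_left,
    three_sub_left]
  ring

variable {L} in
lemma IsLieAlgebroid.deform_d₃_d₂ (hL : L.IsLieAlgebroid) (N : Module.End R Γ)
    (σ : Γ [⋀^Fin 2]→ₗ[R] R) (W X Y Z : Γ) :
    (L.deform N).d₃ (L.d₂ σ) W X Y Z = -L.d₃ (insertEnd N (L.d₂ σ)) W X Y Z := by
  simp only [d₃_deform, hL.d₃_d₂, add_zero, zero_sub]

variable {L} in
lemma insert₂_insertEnd_d₂_sub {N : Module.End R Γ} {σ σN : Γ [⋀^Fin 2]→ₗ[R] R}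
    (hσN : flat σN = flat σ ∘ₗ N) (X Y : Γ) :
    insert₂ (insertEnd N (L.d₂ σ) - L.d₂ σN) X Y =
      L.lieDeriv (N X) (flat σ Y) - L.insertD (N Y) (flat σ X)
        - flat σ ((L.deform N).bracket X Y) + N.dualMap (insert₂ (L.d₂ σ) X Y) := by
  rw [insert₂_sub, insert₂_insertEnd, L.insert₂_d₂ σ (N X), L.insert₂_d₂ σ X (N Y),
    L.insert₂_d₂ σN, hσN]
  simp only [deform, LinearMap.comp_apply, map_add, map_sub]
  abel

end CartanCalculus

section Bivectors

variable (π : Bivector R Γ)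

lemma koszul_bracket_eq (α β : Module.Dual R Γ) :
    (L.koszul π).bracket α β = L.lieDeriv (π.sharp α) β - L.insertD (π.sharp β) α := by
  ext X
  have h : α (π.sharp β) = -β (π.sharp α) := π.eval_swap β α
  simp only [koszul, Bivector.eval, LinearMap.sub_apply, lieDeriv_apply, insertD_apply,
    dFun_apply, h, map_neg]
  ring

lemma schouten_self (α β γ : Module.Dual R Γ) :
    L.schouten π π α β γ =
      2 * γ (L.bracket (π.sharp α) (π.sharp β) - π.sharp ((L.koszul π).bracket α β)) := by
  have hsharp : γ (π.sharp ((L.koszul π).bracket α β)) = -(L.koszul π).bracket α β (π.sharp γ) :=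
    π.eval_swap _ _
  have hβγ : β (π.sharp γ) = -γ (π.sharp β) := π.eval_swap _ _
  have hγα : γ (π.sharp α) = -α (π.sharp γ) := π.eval_swap _ _
  have hαβ : α (π.sharp β) = -β (π.sharp α) := π.eval_swap _ _
  rw [map_sub, hsharp, koszul_bracket_eq]
  simp only [schouten, lieDeriv_apply, insertD_apply, LinearMap.sub_apply]
  rw [L.bracket_swap (π.sharp γ) (π.sharp β), L.bracket_swap (π.sharp β) (π.sharp α)]
  simp only [hβγ, hγα, hαβ, map_neg]
  ring

variable {π} in
lemma concomitant_eq_two_smul {N : Module.End R Γ}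
    (hN : N ∘ₗ π.sharp = π.sharp ∘ₗ N.dualMap) (α β : Module.Dual R Γ) :
    L.concomitant π N α β = (2 : R) •
      (N.dualMap ((L.koszul π).bracket α β) - L.lieDeriv (π.sharp α) (N.dualMap β)
        + L.insertD (π.sharp β) (N.dualMap α)) := by
  have hN' (γ : Module.Dual R Γ) : π.sharp (N.dualMap γ) = N (π.sharp γ) :=
    (LinearMap.congr_fun hN γ).symm
  have hdeform : ((L.koszul π).deform N.dualMap).bracket α β =
      (L.koszul π).bracket (N.dualMap α) β + (L.koszul π).bracket α (N.dualMap β)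
        - N.dualMap ((L.koszul π).bracket α β) := rfl
  rw [concomitant, hdeform]
  simp only [koszul_bracket_eq, lieDeriv_deform, insertD_deform, hN', map_sub]
  module

end Bivectors

section CourantTorsion

variable (H : Γ [⋀^Fin 3]→ₗ[R] R) (π : Bivector R Γ) (N : Module.End R Γ)
  (σ : Γ [⋀^Fin 2]→ₗ[R] R)

/-- The deformation `[u, v]_J = [Ju, v] + [u, Jv] - J[u, v]` of the Dorfman bracket, in terms of
which `T_J(u, v) = [Ju, Jv] - J[u, v]_J`. -/
def deformDorfman (J : Module.End R (Γ × Module.Dual R Γ)) (u v : Γ × Module.Dual R Γ) :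
    Γ × Module.Dual R Γ :=
  L.dorfman H (J u) v + L.dorfman H u (J v) - J (L.dorfman H u v)

lemma courantTorsion_eq (J : Module.End R (Γ × Module.Dual R Γ)) (u v : Γ × Module.Dual R Γ) :
    L.courantTorsion H J u v = L.dorfman H (J u) (J v) - J (L.deformDorfman H J u v) := rfl

lemma deformDorfman_forms (α β : Module.Dual R Γ) :
    L.deformDorfman H (matrixJ π N σ) (0, α) (0, β) = (0, (L.koszul π).bracket α β) := by
  simp only [deformDorfman, dorfman, matrixJ_apply, koszul_bracket_eq, map_zero, zero_add,
    zero_bracket, bracket_zero, zero_lieDeriv, zero_insertD, insert₂_zero_left, insert₂_zero_right,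
    sub_zero, zero_sub, Prod.mk_add_mk, Prod.mk_sub_mk, ← sub_eq_add_neg]

lemma deformDorfman_vectors (X Y : Γ) :
    L.deformDorfman H (matrixJ π N σ) (X, 0) (Y, 0) =
      ((L.deform N).bracket X Y + π.sharp (insert₂ H X Y),
        insert₂ (L.d₂ σ - insertEnd N H) X Y) := by
  simp only [deformDorfman, dorfman, matrixJ_apply, insert₂_sub, insert₂_insertEnd, insert₂_d₂,
    deform, map_zero, map_neg, add_zero, sub_zero, zero_sub, lieDeriv_zero, insertD_zero,
    Prod.mk_add_mk, Prod.mk_sub_mk]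
  congr 1 <;> abel

lemma courantTorsion_forms (α β : Module.Dual R Γ) :
    L.courantTorsion H (matrixJ π N σ) (0, α) (0, β) =
      (L.bracket (π.sharp α) (π.sharp β) - π.sharp ((L.koszul π).bracket α β),
        N.dualMap ((L.koszul π).bracket α β) - L.lieDeriv (π.sharp α) (N.dualMap β)
          + L.insertD (π.sharp β) (N.dualMap α) - insert₂ H (π.sharp α) (π.sharp β)) := by
  simp only [courantTorsion_eq, deformDorfman_forms, dorfman, matrixJ_apply, map_zero, zero_add,
    zero_sub, lieDeriv_neg, insertD_neg, Prod.mk_sub_mk]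
  congr 1
  abel

variable {π N}

lemma courantTorsion_vectors_fst (hN : N ∘ₗ π.sharp = π.sharp ∘ₗ N.dualMap) (X Y : Γ) :
    (L.courantTorsion H (matrixJ π N σ) (X, 0) (Y, 0)).1 =
      L.torsion N X Y + π.sharp (insert₂ H (N X) Y + insert₂ H X (N Y) - insert₂ (L.d₂ σ) X Y) := by
  have hN' : N (π.sharp (insert₂ H X Y)) = π.sharp (N.dualMap (insert₂ H X Y)) :=
    LinearMap.congr_fun hN _
  simp only [courantTorsion_eq, deformDorfman_vectors, dorfman, matrixJ_apply, map_zero, add_zero,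
    Prod.mk_sub_mk, insert₂_sub, insert₂_insertEnd, torsion, map_add, map_sub, hN']
  abel

variable {L σ}

lemma courantTorsion_vectors_snd {c : R}
    (hσπ : ∀ α, flat σ (π.sharp α) = c • α - N.dualMap (N.dualMap α))
    {σN : Γ [⋀^Fin 2]→ₗ[R] R} (hσN : flat σN = flat σ ∘ₗ N) (X Y : Γ) :
    (L.courantTorsion H (matrixJ π N σ) (X, 0) (Y, 0)).2 =
      insert₂ (insertEnd N (L.d₂ σ) - L.d₂ σN - (cyclicForm N H + c • H)) X Y := by
  rw [insert₂_sub, insert₂_insertEnd_d₂_sub hσN]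
  simp only [courantTorsion_eq, deformDorfman_vectors, dorfman, matrixJ_apply, map_zero, add_zero,
    sub_zero, Prod.mk_sub_mk, insert₂_add, insert₂_sub, insert₂_smul, insert₂_insertEnd,
    insert₂_cyclicForm, map_add, map_sub, hσπ]
  abel

end CourantTorsion

section Integrable

variable {L} {H : Γ [⋀^Fin 3]→ₗ[R] R} {π : Bivector R Γ} {N : Module.End R Γ}
  {σ : Γ [⋀^Fin 2]→ₗ[R] R}

lemma isPoisson_of_courantTorsion_eq_zero
    (hT : ∀ u v, L.courantTorsion H (matrixJ π N σ) u v = 0) : L.IsPoisson π := by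
  intro α β γ
  have h := congrArg Prod.fst (hT (0, α) (0, β))
  simp only [courantTorsion_forms] at h
  rw [schouten_self, h, Prod.fst_zero, map_zero, mul_zero]

lemma concomitant_eq_of_courantTorsion_eq_zero (hN : N ∘ₗ π.sharp = π.sharp ∘ₗ N.dualMap)
    (hT : ∀ u v, L.courantTorsion H (matrixJ π N σ) u v = 0) (α β : Module.Dual R Γ) :
    L.concomitant π N α β = (2 : R) • insert₂ H (π.sharp α) (π.sharp β) := by
  have h := congrArg Prod.snd (hT (0, α) (0, β))
  rw [courantTorsion_forms] at h
  rw [L.concomitant_eq_two_smul hN, sub_eq_zero.mp h]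

lemma torsion_eq_of_courantTorsion_eq_zero (hN : N ∘ₗ π.sharp = π.sharp ∘ₗ N.dualMap)
    (hT : ∀ u v, L.courantTorsion H (matrixJ π N σ) u v = 0) (X Y : Γ) :
    L.torsion N X Y =
      -π.sharp (insert₂ H (N X) Y - insert₂ H (N Y) X + insert₂ (-L.d₂ σ) X Y) := by
  have h := congrArg Prod.fst (hT (X, 0) (Y, 0))
  rw [courantTorsion_vectors_fst L H σ hN, insert₂_swap H X] at h
  rw [eq_neg_of_add_eq_zero_left h, insert₂_neg, ← sub_eq_add_neg, ← sub_eq_add_neg]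

lemma insertEnd_d₂_of_courantTorsion_eq_zero {c : R}
    (hσπ : ∀ α, flat σ (π.sharp α) = c • α - N.dualMap (N.dualMap α))
    (hT : ∀ u v, L.courantTorsion H (matrixJ π N σ) u v = 0)
    {σN : Γ [⋀^Fin 2]→ₗ[R] R} (hσN : flat σN = flat σ ∘ₗ N) :
    insertEnd N (L.d₂ σ) = L.d₂ σN + (cyclicForm N H + c • H) := by
  rw [← sub_eq_iff_eq_add', ← sub_eq_zero]
  refine ext_insert₂ fun X Y => ?_
  rw [← courantTorsion_vectors_snd H hσπ hσN, hT]
  rfl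

end Integrable

end SkewAlgebroid

lemma LieAlgebroid.isLieAlgebroid_toSkewAlgebroid
    {E : Type*} [NormedAddCommGroup E] [NormedSpace ℝ E]
    {M : Type*} [TopologicalSpace M] [ChartedSpace E M] [IsManifold 𝓘(ℝ, E) ∞ M]
    {F : Type*} [NormedAddCommGroup F] [NormedSpace ℝ F]
    {V : M → Type*} [TopologicalSpace (Bundle.TotalSpace F V)] [∀ x, TopologicalSpace (V x)]
    [∀ x, AddCommGroup (V x)] [∀ x, Module ℝ (V x)] [FiberBundle F V] [VectorBundle ℝ F V]
    [ContMDiffVectorBundle ∞ F V 𝓘(ℝ, E)] (A : LieAlgebroid E F V) :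
    A.toSkewAlgebroid.IsLieAlgebroid :=
  ⟨A.jacobi, A.anchor_bracket⟩

end Algebroid

end

open Algebroid SkewAlgebroid in
theorem mainTheorem2_general
    {R : Type*} [CommRing R] [Algebra ℝ R] {Γ : Type*} [AddCommGroup Γ] [Module R Γ]
    {L : SkewAlgebroid R Γ} (hL : L.IsLieAlgebroid)
    {π : Bivector R Γ} {N : Module.End R Γ} {σ : Γ [⋀^Fin 2]→ₗ[R] R} {H : Γ [⋀^Fin 3]→ₗ[R] R}
    (hH : ∀ W X Y Z, L.d₃ H W X Y Z = 0) {c : R} (hc : L.dFun c = 0)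
    (hsq : ∀ u, matrixJ π N σ (matrixJ π N σ u) = c • u)
    (hT : ∀ u v, L.courantTorsion H (matrixJ π N σ) u v = 0) :
    L.IsPoissonQuasiNijenhuis π N (-L.d₂ σ) H where
  comm := sharp_comm_of_sq hsq
  closed W X Y Z := by rw [d₃_neg, hL.d₃_d₂, neg_zero]
  closed_background := hH
  poisson := isPoisson_of_courantTorsion_eq_zero hT
  concomitant_eq := concomitant_eq_of_courantTorsion_eq_zero (sharp_comm_of_sq hsq) hT
  torsion_eq := torsion_eq_of_courantTorsion_eq_zero (sharp_comm_of_sq hsq) hT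
  d_eq W X Y Z := by
    have : IsAddTorsionFree R := .of_isTorsionFree ℝ R
    have hσN := flat_formOfFlat _ (isAlt_flat_comp_of_comm (flat_comm_of_sq hsq))
    rw [d₃_neg, hL.deform_d₃_d₂, neg_neg,
      insertEnd_d₂_of_courantTorsion_eq_zero (flat_sharp_of_sq hsq) hT hσN, d₃_add, d₃_add,
      hL.d₃_d₂, d₃_smul_of_dFun_eq_zero hc, hH, mul_zero, add_zero, zero_add]

theorem mainTheorem2
    {E : Type*} [NormedAddCommGroup E] [NormedSpace ℝ E] [FiniteDimensional ℝ E]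
    {M : Type*} [TopologicalSpace M] [T2Space M] [SigmaCompactSpace M]
    [ChartedSpace E M] [IsManifold 𝓘(ℝ, E) ∞ M]
    {F : Type*} [NormedAddCommGroup F] [NormedSpace ℝ F] [FiniteDimensional ℝ F]
    {V : M → Type*} [TopologicalSpace (Bundle.TotalSpace F V)] [∀ x, TopologicalSpace (V x)]
    [∀ x, AddCommGroup (V x)] [∀ x, Module ℝ (V x)] [FiberBundle F V] [VectorBundle ℝ F V]
    [ContMDiffVectorBundle ∞ F V 𝓘(ℝ, E)]
    (A : Algebroid.LieAlgebroid E F V)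
    (π : Algebroid.Bivector C^∞⟮𝓘(ℝ, E), M; ℝ⟯ Cₛ^∞⟮𝓘(ℝ, E); F, V⟯)
    (N : Module.End C^∞⟮𝓘(ℝ, E), M; ℝ⟯ Cₛ^∞⟮𝓘(ℝ, E); F, V⟯)
    (σ : Cₛ^∞⟮𝓘(ℝ, E); F, V⟯ [⋀^Fin 2]→ₗ[C^∞⟮𝓘(ℝ, E), M; ℝ⟯] C^∞⟮𝓘(ℝ, E), M; ℝ⟯)
    (H : Cₛ^∞⟮𝓘(ℝ, E); F, V⟯ [⋀^Fin 3]→ₗ[C^∞⟮𝓘(ℝ, E), M; ℝ⟯] C^∞⟮𝓘(ℝ, E), M; ℝ⟯)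
    (hH : ∀ W X Y Z, A.toSkewAlgebroid.d₃ H W X Y Z = 0)
    (lam : ℝ)
    (hJ : A.toSkewAlgebroid.IsCPS H (Algebroid.matrixJ π N σ) lam) :
    A.toSkewAlgebroid.IsPoissonQuasiNijenhuis π N (-A.toSkewAlgebroid.d₂ σ) H := by
  exact mainTheorem2_general A.isLieAlgebroid_toSkewAlgebroid hH
    (A.toSkewAlgebroid.dFun_algebraMap lam) hJ.sq hJ.integrable
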